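/- Let $\mathit{Sig}$ be a set of function symbols ranked over the natural numbers and let $\mathit{Vars}$ be a set of variables disjoint from $\mathit{Sig}$ (no restriction on cardinalities is needed). A *term* is a possibly infinite ordered labelled tree in which every node is labelled either by a symbol of $\mathit{Sig}$ whose rank equals the number of its immediate descendants, or by a variable, in which case it is a leaf; $\mathrm{vars}(t)$ is the set of variables occurring in $t$. A term $t$ is *ground* if $\mathrm{vars}(t)=\emptyset$; a variable $z$ *occurs linearly* in $t$ if it labels exactly one node of $t$; $t$ is *linear* if each $z\in\mathrm{vars}(t)$ occurs linearly in $t$. A *substitution* $\sigma$ maps variables to finite terms, with $\mathrm{dom}(\sigma)=\{x : \sigma(x)\neq x\}$ finite; it is identified with its finite set of bindings $\{x\mapsto x\sigma : x\in\mathrm{dom}(\sigma)\}$, whose cardinality is $\#\sigma$. It acts homomorphically on finite terms, $t\mapsto t\sigma$, and $t\sigma^i$ is the result of applying $\sigma$ to $t$ successively $i$ times. $\mathit{RSubst}$ is the set of substitutions that have no subset of bindings of the form $\{x_1\mapsto x_2,\dots,x_{k-1}\mapsto x_k,x_k\mapsto x_1\}$ with $k>1$ and $x_1,\dots,x_k$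 distinct variables. For $\sigma\in\mathit{RSubst}$ and a finite term $s$, the sequence $s\sigma^0,s\sigma^1,s\sigma^2,\dots$ converges (at every node the labels are eventually constant) to a possibly infinite term, denoted $\mathrm{rt}(s,\sigma)$. For $\sigma\in\mathit{RSubst}$, $v\in\mathit{Vars}$ and $n=\#\sigma$, put - $\mathrm{occ}(\sigma,v)=\{y\in\mathit{Vars} : v\in\mathrm{vars}(y\sigma^n)\setminus\mathrm{dom}(\sigma)\}$; - $\mathrm{gvars}(\sigma)=\{y\in\mathrm{dom}(\sigma) : \forall v\in\mathit{Vars},\ y\notin\mathrm{occ}(\sigma,v)\}$; - $\mathrm{fvars}(\sigma)=\{y\in\mathit{Vars} : y\sigma^n\in\mathit{Vars}\}$; - $\mathrm{lvars}(\sigma)=\{y\in\mathit{Vars} : \text{every } z\in\mathrm{vars}(y\sigma^n)\setminus\mathrm{dom}(\sigma)\text{ occurs linearly in }y\sigma^{2n}\}$. **Proposition.** If $\sigma\in\mathit{RSubst}$ and $y,v\in\mathit{Vars}$, then 1. $y\in\mathrm{occ}(\sigma,v)\iff v\in\mathrm{vars}(\mathrm{rt}(y,\sigma))$; 2. $y\in\mathrm{gvars}(\sigma)\iff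 \mathrm{rt}(y,\sigma)$ is ground; 3. $y\in\mathrm{fvars}(\sigma)\iff \mathrm{rt}(y,\sigma)\in\mathit{Vars}$; 4. $y\in\mathrm{lvars}(\sigma)\iff \mathrm{rt}(y,\sigma)$ is linear. -/

import Mathlib

namespace RationalTrees

open Filter

universe u u' w

/-- Possibly infinite terms, as ordered labelled trees. The symbols of rank `n` are `L.Functions n`
(relation symbols of `L` play no role), the variables are the elements of `V`. A node is the list
of child indices on the path from the root, and `label p = none` means that `p` is not a node.
A node labelled by a symbol of rank `n` has exactly the children `0, …, n - 1`; a node labelled by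
a variable has none. -/
@[ext]
structure Tree (L : FirstOrder.Language.{u, u'}) (V : Type w) where
  label : List ℕ → Option (V ⊕ Σ n, L.Functions n)
  label_nil : label [] ≠ none
  label_child : ∀ (p : List ℕ) (i : ℕ), label (p ++ [i]) ≠ none ↔
    ∃ (n : ℕ) (f : L.Functions n), label p = some (Sum.inr ⟨n, f⟩) ∧ i < n

variable {L : FirstOrder.Language.{u, u'}} {V : Type w}

namespace Tree

/-- The multiset of variables occurring in `t`: the (possibly infinite) number of occurrences
of each variable. -/
noncomputable def mvars (t : Tree L V) (v : V) : ℕ∞ :=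
  {p : List ℕ | t.label p = some (Sum.inl v)}.encard

/-- The set of variables occurring in `t`. -/
def vars (t : Tree L V) : Set V :=
  {v | ∃ p : List ℕ, t.label p = some (Sum.inl v)}

/-- The variable `v` occurs linearly in `t`. -/
def OccLin (v : V) (t : Tree L V) : Prop := t.mvars v = 1

def IsGround (t : Tree L V) : Prop := t.vars = ∅

def IsLinear (t : Tree L V) : Prop := ∀ v ∈ t.vars, OccLin v t

end Tree

/-- The label of a finite term at a node. -/
def labelAt : L.Term V → List ℕ → Option (V ⊕ Σ n, L.Functions n)
  | .var x, [] => some (Sum.inl x)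
  | .var _, _ :: _ => none
  | .func (l := n) f _, [] => some (Sum.inr ⟨n, f⟩)
  | .func (l := n) _ ts, i :: p => if h : i < n then labelAt (ts ⟨i, h⟩) p else none

theorem labelAt_child (t : L.Term V) (p : List ℕ) (i : ℕ) :
    labelAt t (p ++ [i]) ≠ none ↔
      ∃ (n : ℕ) (f : L.Functions n), labelAt t p = some (Sum.inr ⟨n, f⟩) ∧ i < n := by
  induction t generalizing p with
  | var x => cases p <;> simp [labelAt]
  | @func n f ts ih =>
    cases p with
    | nil =>
      by_cases h : i < n
      · simp only [List.nil_append, labelAt, h, dite_true]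
        refine ⟨fun _ => ⟨n, f, rfl, h⟩, fun _ => ?_⟩
        cases ts ⟨i, h⟩ <;> simp [labelAt]
      · simp only [List.nil_append, labelAt, h, dite_false]
        refine ⟨fun h' => (h' rfl).elim, ?_⟩
        rintro ⟨m, g, hm, hi⟩
        simp only [Option.some.injEq, Sum.inr.injEq] at hm
        cases hm
        exact (h hi).elim
    | cons j q =>
      by_cases h : j < n
      · simp only [List.cons_append, labelAt, h, dite_true]
        exact ih ⟨j, h⟩ q
      · simp [labelAt, h]

/-- The tree of a finite term: finite terms are identified with their trees. -/
def toTree (t : L.Term V) : Tree L V where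
  label := labelAt t
  label_nil := by cases t <;> simp [labelAt]
  label_child := labelAt_child t

/-- The tree `t` is (the one-node tree of) a variable. -/
def Tree.IsFree (t : Tree L V) : Prop := ∃ x : V, t = toTree (FirstOrder.Language.Term.var x)

variable (L V) in
/-- Substitutions: maps from variables to finite terms which are the identity almost everywhere. -/
structure Substitution where
  toFun : V → L.Term V
  finite_dom' : {x : V | toFun x ≠ FirstOrder.Language.Term.var x}.Finite

namespace Substitution

def dom (σ : Substitution L V) : Set V := {x | σ.toFun x ≠ FirstOrder.Language.Term.var x}

/-- The application `tσ` of a substitution to a finite term. -/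
def apply (t : L.Term V) (σ : Substitution L V) : L.Term V := t.subst σ.toFun

/-- The set of bindings `x ↦ xσ`, `x ∈ dom σ`, with which `σ` is identified. -/
def bindings (σ : Substitution L V) : Set (V × L.Term V) :=
  {b | b.1 ∈ σ.dom ∧ b.2 = σ.toFun b.1}

/-- The number of bindings of `σ`. -/
noncomputable def card (σ : Substitution L V) : ℕ := σ.bindings.ncard

/-- The empty substitution. -/
def id : Substitution L V where
  toFun := FirstOrder.Language.Term.var
  finite_dom' := by simp

/-- The composition `τ ∘ σ`, which maps `t` to `(tσ)τ`. -/
def comp (τ σ : Substitution L V) : Substitution L V where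
  toFun x := apply (σ.toFun x) τ
  finite_dom' := by
    refine (σ.finite_dom'.union τ.finite_dom').subset fun x hx => ?_
    by_contra h
    simp only [Set.mem_union, Set.mem_ofPred_eq, not_or, not_not] at h
    exact hx (by simp [apply, h.1, h.2, FirstOrder.Language.Term.subst])

/-- The powers `σ ^ 0 = id`, `σ ^ (i + 1) = σ ∘ σ ^ i`. -/
def pow (σ : Substitution L V) : ℕ → Substitution L V
  | 0 => id
  | i + 1 => comp σ (pow σ i)

/-- A set of bindings of the form `{x₁ ↦ x₂, …, xₖ₋₁ ↦ xₖ, xₖ ↦ x₁}` with `k > 1` and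
`x₁, …, xₖ` distinct; here `k = m + 2`, and addition in `Fin (m + 2)` is cyclic. -/
def IsCircular (B : Set (V × L.Term V)) : Prop :=
  ∃ (m : ℕ) (x : Fin (m + 2) → V), Function.Injective x ∧
    B = Set.range fun i => (x i, FirstOrder.Language.Term.var (x (i + 1)))

/-- Rational solved form: no circular subset. -/
def IsRationalSolvedForm (σ : Substitution L V) : Prop :=
  ∀ B ⊆ σ.bindings, ¬ IsCircular B

theorem apply_id (t : L.Term V) : apply t id = t := by
  induction t with
  | var x => rfl
  | func f ts ih => simpa [apply, id, FirstOrder.Language.Term.subst, funext_iff] using ih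

theorem apply_comp (t : L.Term V) (τ σ : Substitution L V) :
    apply t (comp τ σ) = apply (apply t σ) τ := by
  induction t with
  | var x => rfl
  | func f ts ih => simpa [apply, comp, FirstOrder.Language.Term.subst, funext_iff] using ih

theorem apply_pow_succ (t : L.Term V) (σ : Substitution L V) (i : ℕ) :
    apply t (pow σ (i + 1)) = apply (apply t (pow σ i)) σ := apply_comp t σ (pow σ i)

theorem apply_pow_add (t : L.Term V) (σ : Substitution L V) (i j : ℕ) :
    apply t (pow σ (i + j)) = apply (apply t (pow σ i)) (pow σ j) := by
  induction j with
  | zero => simp [pow, apply_id]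
  | succ j ih => rw [← add_assoc, apply_pow_succ, ih, ← apply_pow_succ]

end Substitution

/-- The sequence of trees `s` converges to `t`: at each node the labels are eventually those
of `t`. As all ranks are finite, this is agreement up to any given depth from some index on. -/
def ConvergesTo (s : ℕ → Tree L V) (t : Tree L V) : Prop :=
  ∀ p : List ℕ, ∀ᶠ i in atTop, (s i).label p = t.label p

section WellDefined

open Substitution

/-- Under a substitution in rational solved form, the iterates of a term reach either a compound
term or a variable outside the domain. -/
theorem iterates_reach {σ : Substitution L V} (hσ : σ.IsRationalSolvedForm) (x : V) :
    ∃ N : ℕ, (∃ (n : ℕ) (f : L.Functions n) (ts : Fin n → L.Term V),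
        apply (.var x) (pow σ N) = .func f ts) ∨
      ∃ z : V, z ∉ σ.dom ∧ apply (.var x) (pow σ N) = .var z := by
  by_contra! hcon
  have hvar : ∀ N, ∃ z, z ∈ σ.dom ∧ apply (.var x) (pow σ N) = .var z := by
    intro N
    obtain ⟨h1, h2⟩ := hcon N
    rcases h : apply (L := L) (.var x) (pow σ N) with z | ⟨f, ts⟩
    · refine ⟨z, ?_, rfl⟩
      by_contra hz
      exact h2 z hz h
    · exact (h1 _ _ _ h).elim
  choose z hz hzN using hvar
  have hstep : ∀ N, σ.toFun (z N) = .var (z (N + 1)) := by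
    intro N
    rw [← hzN (N + 1), apply_pow_succ, hzN N]
    rfl
  obtain ⟨a, b, hab, hzab⟩ : ∃ a b, a < b ∧ z a = z b := by
    have hfin : σ.dom.Finite := σ.finite_dom'
    obtain ⟨a, -, b, -, hne, h⟩ := Set.infinite_univ.exists_ne_map_eq_of_mapsTo
      (f := z) (t := σ.dom) (fun N _ => hz N) hfin
    rcases lt_or_gt_of_ne hne with h' | h'
    · exact ⟨a, b, h', h⟩
    · exact ⟨b, a, h', h.symm⟩
  classical
  let g : V → V := fun y => if h : ∃ w, σ.toFun y = .var w then h.choose else y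
  have hg : ∀ N, g (z N) = z (N + 1) := by
    intro N
    have h : ∃ w, σ.toFun (z N) = .var w := ⟨_, hstep N⟩
    have h2 := h.choose_spec
    simp only [g, dif_pos h]
    exact (FirstOrder.Language.Term.var.inj ((hstep N).symm.trans h2)).symm
  have hgit : ∀ k, g^[k] (z a) = z (a + k) := by
    intro k
    induction k with
    | zero => rfl
    | succ k ih => rw [Function.iterate_succ_apply', ih, hg]; rfl
  have hper : Function.IsPeriodicPt g (b - a) (z a) := by
    change g^[b - a] (z a) = z a
    rw [hgit, hzab]; congr 1; omega
  have hpos := hper.minimalPeriod_pos (by omega)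
  have hne1 : Function.minimalPeriod g (z a) ≠ 1 := by
    intro h1
    have h : g (z a) = z a := Function.minimalPeriod_eq_one_iff_isFixedPt.1 h1
    rw [hg] at h
    exact hz a (by rw [hstep, h])
  obtain ⟨m, hm⟩ : ∃ m, Function.minimalPeriod g (z a) = m + 2 :=
    ⟨Function.minimalPeriod g (z a) - 2, by omega⟩
  refine hσ (Set.range fun i : Fin (m + 2) => (z (a + i.1),
    FirstOrder.Language.Term.var (z (a + (i + 1).1)))) ?_ ⟨m, fun i => z (a + i.1), ?_, rfl⟩
  · rintro _ ⟨i, rfl⟩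
    refine ⟨hz _, ?_⟩
    have : z (a + (i + 1 : Fin (m + 2)).1) = z (a + i.1 + 1) := by
      have h := Function.iterate_mod_minimalPeriod_eq (f := g) (x := z a) (n := i.1 + 1)
      rw [hm] at h
      rw [← hgit, add_assoc, ← hgit, Fin.val_add, Fin.val_one, h]
    rw [hstep, ← this]
  · intro i j hij
    simp only [← hgit] at hij
    have := (Function.iterate_eq_iterate_iff_of_lt_minimalPeriod
      (by rw [hm]; exact i.2) (by rw [hm]; exact j.2)).1 hij
    exact Fin.ext this

theorem labels_stabilize {σ : Substitution L V} (hσ : σ.IsRationalSolvedForm) (p : List ℕ)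
    (s : L.Term V) : ∃ c, ∀ᶠ i in atTop, labelAt (apply s (pow σ i)) p = c := by
  have hfun : ∀ (i n : ℕ) (f : L.Functions n) (ts : Fin n → L.Term V),
      apply (.func f ts) (pow σ i) = .func f fun j => apply (ts j) (pow σ i) := fun _ _ _ _ => rfl
  induction p generalizing s with
  | nil =>
    have key : ∀ (n : ℕ) (f : L.Functions n) (ts : Fin n → L.Term V),
        ∃ c, ∀ᶠ i in atTop, labelAt (apply (.func f ts) (pow σ i)) [] = c :=
      fun n f ts => ⟨_, Eventually.of_forall fun i => by rw [hfun]; rfl⟩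
    rcases s with x | ⟨f, ts⟩
    · obtain ⟨N, ⟨n, f, ts, h⟩ | ⟨z, hz, h⟩⟩ := iterates_reach hσ x
      · obtain ⟨c, hc⟩ := key n f ts
        refine ⟨c, ?_⟩
        rw [← h] at hc
        rw [eventually_atTop] at hc ⊢
        obtain ⟨M, hM⟩ := hc
        refine ⟨N + M, fun i hi => ?_⟩
        have := hM (i - N) (by omega)
        rwa [← apply_pow_add, Nat.add_sub_cancel' (by omega)] at this
      · refine ⟨some (Sum.inl z), ?_⟩
        have hfix : ∀ k, apply (L := L) (.var x) (pow σ (N + k)) = .var z := by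
          intro k
          induction k with
          | zero => exact h
          | succ k ih => rw [← add_assoc, apply_pow_succ, ih]; exact not_not.1 hz
        filter_upwards [eventually_ge_atTop N] with i hi
        have := hfix (i - N)
        rw [Nat.add_sub_cancel' hi] at this
        rw [this]; rfl
    · exact key _ f ts
  | cons j q ih =>
    have key : ∀ (n : ℕ) (f : L.Functions n) (ts : Fin n → L.Term V),
        ∃ c, ∀ᶠ i in atTop, labelAt (apply (.func f ts) (pow σ i)) (j :: q) = c := by
      intro n f ts
      by_cases hj : j < n
      · obtain ⟨c, hc⟩ := ih (ts ⟨j, hj⟩)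
        refine ⟨c, hc.mono fun i hi => ?_⟩
        rw [hfun]
        simpa [labelAt, hj] using hi
      · exact ⟨none, Eventually.of_forall fun i => by rw [hfun]; simp [labelAt, hj]⟩
    rcases s with x | ⟨f, ts⟩
    · obtain ⟨N, ⟨n, f, ts, h⟩ | ⟨z, hz, h⟩⟩ := iterates_reach hσ x
      · obtain ⟨c, hc⟩ := key n f ts
        refine ⟨c, ?_⟩
        rw [← h] at hc
        rw [eventually_atTop] at hc ⊢
        obtain ⟨M, hM⟩ := hc
        refine ⟨N + M, fun i hi => ?_⟩
        have := hM (i - N) (by omega)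
        rwa [← apply_pow_add, Nat.add_sub_cancel' (by omega)] at this
      · refine ⟨none, ?_⟩
        have hfix : ∀ k, apply (L := L) (.var x) (pow σ (N + k)) = .var z := by
          intro k
          induction k with
          | zero => exact h
          | succ k ih => rw [← add_assoc, apply_pow_succ, ih]; exact not_not.1 hz
        filter_upwards [eventually_ge_atTop N] with i hi
        have := hfix (i - N)
        rw [Nat.add_sub_cancel' hi] at this
        rw [this]; rfl
    · exact key _ f ts

/-- For `σ` in rational solved form the sequence `σ⁰(s), σ¹(s), σ²(s), …` converges to a unique
tree. -/
theorem existsUnique_limit {σ : Substitution L V} (hσ : σ.IsRationalSolvedForm) (s : L.Term V) :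
    ∃! t : Tree L V, ConvergesTo (fun i => toTree (apply s (pow σ i))) t := by
  choose c hc using fun p => labels_stabilize hσ p s
  refine ⟨⟨c, ?_, ?_⟩, hc, ?_⟩
  · obtain ⟨i, hi⟩ := (hc []).exists
    rw [← hi]
    exact (toTree (apply s (pow σ i))).label_nil
  · intro p j
    obtain ⟨i, hi, hi'⟩ := ((hc p).and (hc (p ++ [j]))).exists
    rw [← hi, ← hi']
    exact labelAt_child _ p j
  · intro t ht
    ext1
    funext p
    obtain ⟨i, hi, hi'⟩ := ((hc p).and (ht p)).exists
    exact hi'.symm.trans hi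

end WellDefined

variable (L V) in
/-- The substitutions in rational solved form. -/
def RSubst : Type (max u w) := {σ : Substitution L V // σ.IsRationalSolvedForm}

/-- `rt s σ = σ^∞(s)`, the limit of the sequence `σ⁰(s), σ¹(s), σ²(s), …`. -/
noncomputable def rt (s : L.Term V) (σ : RSubst L V) : Tree L V :=
  (existsUnique_limit σ.2 s).choose

theorem rt_spec (s : L.Term V) (σ : RSubst L V) :
    ConvergesTo (fun i => toTree (Substitution.apply s (σ.1.pow i))) (rt s σ) :=
  (existsUnique_limit σ.2 s).choose_spec.1

namespace RSubst

def dom (σ : RSubst L V) : Set V := σ.1.dom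

/-- The number of bindings of `σ`. -/
noncomputable def card (σ : RSubst L V) : ℕ := σ.1.card

/-- The finite term `yσⁱ` obtained from the variable `y`, as a tree. -/
def iter (σ : RSubst L V) (y : V) (i : ℕ) : Tree L V :=
  toTree (Substitution.apply (FirstOrder.Language.Term.var y) (σ.1.pow i))

/-- The occurrence operator. -/
def occ (σ : RSubst L V) (v : V) : Set V :=
  {y | v ∈ (σ.iter y σ.card).vars \ σ.dom}

/-- The groundness operator. -/
def gvars (σ : RSubst L V) : Set V :=
  {y | y ∈ σ.dom ∧ ∀ v : V, y ∉ σ.occ v}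

/-- The freeness operator. -/
def fvars (σ : RSubst L V) : Set V :=
  {y | (σ.iter y σ.card).IsFree}

/-- The linearity operator. -/
def lvars (σ : RSubst L V) : Set V :=
  {y | ∀ z ∈ (σ.iter y σ.card).vars \ σ.dom, Tree.OccLin z (σ.iter y (2 * σ.card))}

end RSubst

end RationalTrees

namespace RationalTrees

open Filter FirstOrder.Language Substitution

universe u u' w

variable {L : FirstOrder.Language.{u, u'}} {V : Type w}

/-! Fix `v` outside the domain and a cap `k`, and let `m i x` be the number of occurrences of `v` in
`xσⁱ`, cut off at `k`. A leaf labelled `v` is never rewritten, so `m` increases with `i`; off the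
domain it is constant. Since `xσⁱ⁺¹ = (xσ)σⁱ`, the function `m (i + 1)` is determined by `m i`, so
one stationary step makes the sequence stationary forever. Until then the sum of `m i` over the
domain grows by at least one per step, and it never exceeds `k * #σ`: everything is settled after `k
* #σ` steps (`min_varCount_pow_eq`).

The capped counts therefore agree with those of the limit tree (`le_mvars_rt_iff`). The cap `k = 1`
decides occurrence after `n` steps, hence groundness; caps 1 and 2 together decide linearity after
`2n` steps. For freeness, the same argument with `k = 1` runs on the indicator of "`xσⁱ` is not a
domain variable" (`notMem_dom_of_pow_card`); this is where the absence of circular bindings enters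
directly. -/

/-! ### Stationarity of bounded monotone sequences. -/

/-- A monotone sequence of functions that are bounded by `k` on a finite set `D`, constant in time
off `D`, and such that one stationary step forces the next one to be stationary, is stationary
from the index `k * D.ncard` on. -/
theorem eq_of_stationary_step {D : Set V} (hD : D.Finite) (k : ℕ) (m : ℕ → V → ℕ)
    (hmono : Monotone m) (hle : ∀ i, ∀ x ∈ D, m i x ≤ k) (hoff : ∀ i, ∀ x ∉ D, m i x = m 0 x)
    (hstep : ∀ i, m i = m (i + 1) → m (i + 1) = m (i + 2)) {i : ℕ} (hi : k * D.ncard ≤ i) :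
    m i = m (k * D.ncard) := by
  have hstat : ∀ i, m i = m (i + 1) → ∀ j, m (i + j) = m i := by
    intro i h
    have h' : ∀ j, m (i + j) = m (i + j + 1) := by
      intro j
      induction j with
      | zero => exact h
      | succ j ih => exact hstep _ ih
    intro j
    induction j with
    | zero => rfl
    | succ j ih => rw [← add_assoc, ← h' j, ih]
  obtain ⟨j, hj, hjeq⟩ : ∃ j ≤ k * D.ncard, m j = m (j + 1) := by
    by_contra! hne
    -- Without a stationary step, the sum over `D` gains at least one each time, and so exceeds its
    -- bound `k * D.ncard` after one step more than that.
    have hpot : ∀ j ≤ k * D.ncard + 1, j ≤ ∑ x ∈ hD.toFinset, m j x := by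
      intro j
      induction j with
      | zero => simp
      | succ j ih =>
        intro hj
        refine Nat.succ_le_of_lt ((ih (by omega)).trans_lt ?_)
        refine Finset.sum_lt_sum (fun x _ => hmono (Nat.le_succ j) x) ?_
        by_contra! hx
        refine hne j (by omega) (funext fun x => ?_)
        by_cases hxD : x ∈ D
        · exact le_antisymm (hmono (Nat.le_succ j) x) (hx x (by simpa using hxD))
        · rw [hoff _ x hxD, hoff (j + 1) x hxD]
    have h1 := hpot _ le_rfl
    have h2 : ∑ x ∈ hD.toFinset, m (k * D.ncard + 1) x ≤ hD.toFinset.card • k :=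
      Finset.sum_le_card_nsmul _ _ _ fun x hx => hle _ x (by simpa using hx)
    rw [← Set.ncard_eq_toFinset_card D hD, smul_eq_mul, Nat.mul_comm D.ncard k] at h2
    omega
  have hk := hstat j hjeq (k * D.ncard - j)
  have hi' := hstat j hjeq (i - j)
  rw [Nat.add_sub_cancel' hj] at hk
  rw [Nat.add_sub_cancel' (hj.trans hi)] at hi'
  rw [hk, hi']

/-! ### Counting occurrences in finite terms. -/

open Classical in
/-- The number of occurrences of a variable in a finite term. -/
noncomputable def varCount (v : V) : L.Term V → ℕ
  | .var x => if x = v then 1 else 0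
  | .func _ ts => ∑ i, varCount v (ts i)

/-- The occurrences in a compound term are the disjoint union, over the first child index, of those
in its arguments. -/
theorem mvars_toTree (v : V) (t : L.Term V) : (toTree t).mvars v = varCount v t := by
  induction t with
  | var x =>
    have : {p : List ℕ | labelAt (L := L) (.var x) p = some (Sum.inl v)} =
        {p | p = [] ∧ x = v} := by
      ext p
      cases p <;> simp [labelAt]
    change Set.encard {p : List ℕ | labelAt (L := L) (.var x) p = some (Sum.inl v)} = _
    rw [this]
    by_cases h : x = v <;> simp [varCount, h]
  | @func n f ts ih =>
    have : {p : List ℕ | labelAt (.func f ts) p = some (Sum.inl v)} =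
        ⋃ i : Fin n, List.cons i.1 '' {p | labelAt (ts i) p = some (Sum.inl v)} := by
      ext p
      rcases p with _ | ⟨j, q⟩
      · simp [labelAt]
      · by_cases hj : j < n
        · simp only [Set.mem_ofPred_eq, labelAt, hj, dite_true, Set.mem_iUnion, Set.mem_image,
            List.cons.injEq]
          refine ⟨fun h => ⟨⟨j, hj⟩, q, h, rfl, rfl⟩, ?_⟩
          rintro ⟨i, q, h, rfl, rfl⟩
          exact h
        · simp only [Set.mem_ofPred_eq, labelAt, hj, dite_false, Set.mem_iUnion, Set.mem_image,
            List.cons.injEq, reduceCtorEq, false_iff]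
          rintro ⟨i, q, -, rfl, -⟩
          exact hj i.2
    simp only [Tree.mvars, toTree] at ih ⊢
    rw [this, Set.encard_iUnion_of_finite]
    · rw [finsum_eq_sum_of_fintype]
      simp only [varCount, Nat.cast_sum]
      refine Finset.sum_congr rfl fun i _ => ?_
      rw [(List.cons_injective).encard_image, ih]
    · intro i j hij
      rw [Function.onFun, Set.disjoint_left]
      rintro _ ⟨p, -, rfl⟩ ⟨q, -, h⟩
      exact hij (Fin.ext (List.cons.inj h).1.symm)

theorem min_sum_congr {ι : Type*} (s : Finset ι) (k : ℕ) (a b : ι → ℕ)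
    (h : ∀ i, min k (a i) = min k (b i)) : min k (∑ i ∈ s, a i) = min k (∑ i ∈ s, b i) := by
  classical
  induction s using Finset.induction_on with
  | empty => rfl
  | insert i s hi ih =>
    rw [Finset.sum_insert hi, Finset.sum_insert hi]
    have := h i
    omega

/-- A sum cut off at `k` depends only on its summands cut off at `k`. This lets the capped counts of
one iterate determine those of the next. -/
theorem min_varCount_subst_congr (v : V) (k : ℕ) {s s' : V → L.Term V}
    (h : ∀ x, min k (varCount v (s x)) = min k (varCount v (s' x))) (t : L.Term V) :
    min k (varCount v (t.subst s)) = min k (varCount v (t.subst s')) := by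
  induction t with
  | var x => exact h x
  | func f ts ih => exact min_sum_congr _ _ _ _ ih

theorem labelAt_subst_of_var {t : L.Term V} {p : List ℕ} {x : V}
    (h : labelAt t p = some (Sum.inl x)) (s : V → L.Term V) :
    labelAt (t.subst s) p = labelAt (s x) [] := by
  induction t generalizing p with
  | var y =>
    cases p with
    | nil =>
      obtain rfl : y = x := by simpa [labelAt] using h
      rfl
    | cons j q => simp [labelAt] at h
  | @func n f ts ih =>
    cases p with
    | nil => simp [labelAt] at h
    | cons j q =>
      by_cases hj : j < n
      · simp only [labelAt, hj, dite_true] at h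
        simpa [FirstOrder.Language.Term.subst, labelAt, hj] using ih ⟨j, hj⟩ h
      · simp [labelAt, hj] at h

theorem labelAt_nil_eq_var_iff {t : L.Term V} {x : V} :
    labelAt t [] = some (Sum.inl x) ↔ t = .var x := by
  cases t <;> simp [labelAt]

/-! ### Iterates of a substitution. -/

namespace Substitution

variable {σ : Substitution L V}

theorem toFun_of_notMem_dom {x : V} (hx : x ∉ σ.dom) : σ.toFun x = .var x := not_not.1 hx

theorem card_eq_ncard_dom (σ : Substitution L V) : σ.card = σ.dom.ncard := by
  have : σ.bindings = (fun x => (x, σ.toFun x)) '' σ.dom := by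
    ext ⟨x, t⟩
    constructor
    · rintro ⟨hx, ht⟩
      exact ⟨x, hx, Prod.ext rfl ht.symm⟩
    · rintro ⟨y, hy, h⟩
      cases h
      exact ⟨hy, rfl⟩
  rw [card, this]
  exact Set.ncard_image_of_injective _ fun x y h => congrArg Prod.fst h

/-- Splits off the first application of `σ`, where `apply_pow_succ` splits off the last; the
recursion of the stationarity argument needs this form. -/
theorem apply_var_pow_succ (x : V) (i : ℕ) :
    apply (.var x) (σ.pow (i + 1)) = apply (σ.toFun x) (σ.pow i) := by
  rw [add_comm, apply_pow_add]
  rfl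

theorem apply_var_pow_of_notMem_dom {x : V} (hx : x ∉ σ.dom) (i : ℕ) :
    apply (.var x) (σ.pow i) = .var x := by
  induction i with
  | zero => rfl
  | succ i ih => rw [apply_pow_succ, ih]; exact toFun_of_notMem_dom hx

theorem labelAt_pow_of_var {t : L.Term V} {p : List ℕ} {v : V} (hv : v ∉ σ.dom) {i j : ℕ}
    (hij : i ≤ j) (h : labelAt (apply t (σ.pow i)) p = some (Sum.inl v)) :
    labelAt (apply t (σ.pow j)) p = some (Sum.inl v) := by
  induction j, hij using Nat.le_induction with
  | base => exact h
  | succ j _ ih =>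
    rw [apply_pow_succ, apply, labelAt_subst_of_var ih, toFun_of_notMem_dom hv]
    rfl

theorem varCount_pow_mono {v : V} (hv : v ∉ σ.dom) (t : L.Term V) :
    Monotone fun i => varCount v (apply t (σ.pow i)) := by
  intro i j hij
  have : (toTree (apply t (σ.pow i))).mvars v ≤ (toTree (apply t (σ.pow j))).mvars v :=
    Set.encard_le_encard fun p hp => labelAt_pow_of_var hv hij hp
  simpa [mvars_toTree] using this

theorem min_varCount_pow_eq {v : V} (hv : v ∉ σ.dom) (k : ℕ) (y : V) {i : ℕ}
    (hi : k * σ.card ≤ i) :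
    min k (varCount v (apply (.var y) (σ.pow i))) =
      min k (varCount v (apply (.var y) (σ.pow (k * σ.card)))) := by
  rw [card_eq_ncard_dom] at hi ⊢
  refine congrFun (eq_of_stationary_step (D := σ.dom) σ.finite_dom' k
    (fun i x => min k (varCount v (apply (.var x) (σ.pow i)))) ?_ ?_ ?_ ?_ hi) y
  · exact fun i j hij x => min_le_min le_rfl (varCount_pow_mono hv _ hij)
  · exact fun i x _ => min_le_left _ _
  · intro i x hx
    simp only [apply_var_pow_of_notMem_dom hx]
  · intro i h
    funext x
    simp only [apply_var_pow_succ x i, apply_var_pow_succ x (i + 1)]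
    exact min_varCount_subst_congr v k (congrFun h) _

/-- After as many steps as there are bindings, a variable is no longer mapped into the domain. -/
theorem IsRationalSolvedForm.notMem_dom_of_pow_card (hσ : σ.IsRationalSolvedForm) {y z : V}
    (h : apply (.var y) (σ.pow σ.card) = .var z) : z ∉ σ.dom := by
  classical
  -- The value changes at most once, from 0 to 1: a compound term or a variable outside the domain
  -- never turns back into a domain variable.
  let m : ℕ → V → ℕ := fun i x => if ∃ w ∈ σ.dom, apply (.var x) (σ.pow i) = .var w then 0 else 1
  have hsucc : ∀ i x, m (i + 1) x = if h : ∃ w, σ.toFun x = .var w then m i h.choose else 1 := by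
    intro i x
    split_ifs with hw
    · have := hw.choose_spec
      simp only [m, apply_var_pow_succ, ← this]
    · refine if_neg ?_
      rintro ⟨w, -, h⟩
      rw [apply_var_pow_succ] at h
      rcases hx : σ.toFun x with u | ⟨f, ts⟩
      · exact hw ⟨u, hx⟩
      · rw [hx] at h
        cases h
  have hmono : Monotone m := by
    refine monotone_nat_of_le_succ fun i x => ?_
    by_cases h1 : ∃ w ∈ σ.dom, apply (.var x) (σ.pow (i + 1)) = .var w
    · have h0 : ∃ w ∈ σ.dom, apply (.var x) (σ.pow i) = .var w := by
        obtain ⟨w, hw, h⟩ := h1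
        rw [apply_pow_succ] at h
        rcases hx : apply (L := L) (.var x) (σ.pow i) with u | ⟨f, ts⟩
        · refine ⟨u, fun hu => ?_, rfl⟩
          rw [hx, show apply (.var u) σ = .var u from hu] at h
          cases h
          exact hw hu
        · rw [hx] at h
          cases h
      simp [m, h0]
    · simp only [m, if_neg h1]
      split_ifs <;> simp
  have hst := fun i hi => congrFun (eq_of_stationary_step (D := σ.dom) σ.finite_dom' 1 m hmono
    (fun i x _ => by simp only [m]; split_ifs <;> simp)
    (fun i x hx => by simp only [m, apply_var_pow_of_notMem_dom hx])
    (fun i h => funext fun x => by rw [hsucc, hsucc, h]) (i := i) hi) y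
  rw [one_mul, ← card_eq_ncard_dom] at hst
  -- Rational solved form forces the value 1 at some index `N`, so the value that is stationary from
  -- `σ.card` on cannot be 0.
  obtain ⟨N, hN⟩ := iterates_reach hσ y
  have hmN : m N y = 1 := by
    refine if_neg ?_
    rintro ⟨w, hw, h⟩
    obtain ⟨n, f, ts, h'⟩ | ⟨z, hz, h'⟩ := hN
    · rw [h'] at h
      cases h
    · rw [h'] at h
      cases h
      exact hz hw
  intro hz
  have h0 : m σ.card y = 0 := if_pos ⟨z, hz, h⟩
  have h1 : m (max N σ.card) y = m σ.card y := hst _ (le_max_right _ _)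
  have h2 : m N y ≤ m (max N σ.card) y := hmono (le_max_left N σ.card) y
  rw [h1, hmN, h0] at h2
  exact Nat.not_succ_le_zero 0 h2

end Substitution

/-! ### Comparison of the iterates with the limit tree. -/

namespace Tree

variable {t : Tree L V} {v : V}

theorem mem_vars_iff : v ∈ t.vars ↔ ((1 : ℕ) : ℕ∞) ≤ t.mvars v := by
  rw [Nat.cast_one, mvars, Set.one_le_encard_iff_nonempty]
  rfl

theorem occLin_iff : OccLin v t ↔
    ((1 : ℕ) : ℕ∞) ≤ t.mvars v ∧ ¬ ((2 : ℕ) : ℕ∞) ≤ t.mvars v := by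
  rw [OccLin]
  generalize t.mvars v = a
  induction a using ENat.recTopCoe with
  | top => simp
  | coe a =>
    norm_cast
    omega

end Tree

variable {σ : RSubst L V} {v y : V}

/-- Two consecutive iterates carry `v` at the same node; the second carries there the root label of
`vσ`, so `vσ = v`. -/
theorem notMem_dom_of_mem_vars_rt {s : L.Term V} (hv : v ∈ (rt s σ).vars) : v ∉ σ.dom := by
  obtain ⟨p, hp⟩ := hv
  obtain ⟨i, h, h'⟩ := ((rt_spec s σ p).and ((tendsto_add_atTop_nat 1).eventually
    (rt_spec s σ p))).exists
  rw [hp] at h h'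
  have h1 : labelAt (apply s (σ.1.pow i)) p = some (Sum.inl v) := h
  have h2 : labelAt (apply s (σ.1.pow (i + 1))) p = some (Sum.inl v) := h'
  rw [apply_pow_succ, apply, labelAt_subst_of_var h1, labelAt_nil_eq_var_iff] at h2
  exact not_not.2 h2

/-- Up to a bound `k`, the occurrences of a variable outside the domain in `rt y σ` are already
found after `k * σ.card` steps. -/
theorem le_mvars_rt_iff (hv : v ∉ σ.dom) (k : ℕ) {i : ℕ} (hi : k * σ.card ≤ i) :
    (k : ℕ∞) ≤ (rt (.var y) σ).mvars v ↔ (k : ℕ∞) ≤ (σ.iter y i).mvars v := by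
  constructor
  · intro h
    -- Convergence is only nodewise, so `k` of the possibly infinitely many occurrences are
    -- selected: a finite set of nodes reaches its limit labels at a common index.
    obtain ⟨T, hT, hTk⟩ := Set.exists_subset_encard_eq h
    have hfin : T.Finite := Set.finite_of_encard_eq_coe hTk
    have hev : ∀ᶠ j in atTop, ∀ p ∈ T,
        (toTree (apply (.var y) (σ.1.pow j))).label p = (rt (.var y) σ).label p :=
      (Filter.eventually_all_finite hfin).2 fun p _ => rt_spec (.var y) σ p
    obtain ⟨j, hj, hij⟩ := (hev.and (eventually_ge_atTop i)).exists
    have hk : (k : ℕ∞) ≤ (toTree (apply (.var y) (σ.1.pow j))).mvars v := by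
      rw [← hTk]
      exact Set.encard_le_encard fun p hp => (hj p hp).trans (hT hp)
    rw [RSubst.iter, mvars_toTree]
    rw [mvars_toTree] at hk
    norm_cast at hk ⊢
    -- The capped counts at `i` and at `j` both equal the one at `k * σ.card`, which carries the
    -- bound from `j` back to `i`.
    have h1 := min_varCount_pow_eq hv k y hi
    have h2 := min_varCount_pow_eq hv k y (hi.trans hij)
    omega
  · intro h
    refine h.trans (Set.encard_le_encard fun p hp => ?_)
    obtain ⟨j, hj, hij⟩ := ((rt_spec (.var y) σ p).and (eventually_ge_atTop i)).exists
    exact hj.symm.trans (labelAt_pow_of_var hv hij hp)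

theorem mem_occ_iff_mem_vars_rt : y ∈ σ.occ v ↔ v ∈ (rt (.var y) σ).vars := by
  have key : v ∉ σ.dom → (v ∈ (rt (.var y) σ).vars ↔ v ∈ (σ.iter y σ.card).vars) := fun hv => by
    rw [Tree.mem_vars_iff, Tree.mem_vars_iff, le_mvars_rt_iff hv 1 (one_mul _).le]
  exact ⟨fun h => (key h.2).2 h.1, fun h => ⟨(key (notMem_dom_of_mem_vars_rt h)).1 h,
    notMem_dom_of_mem_vars_rt h⟩⟩

theorem rt_eq_of_iter_eq_var {z : V} {i : ℕ} (hz : z ∉ σ.dom)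
    (h : apply (.var y) (σ.1.pow i) = .var z) : rt (.var y) σ = toTree (.var z) := by
  ext1
  funext p
  obtain ⟨j, hj, hij⟩ := ((rt_spec (.var y) σ p).and (eventually_ge_atTop i)).exists
  have hfix : apply (.var y) (σ.1.pow j) = .var z := by
    rw [← Nat.add_sub_cancel' hij, apply_pow_add, h, apply_var_pow_of_notMem_dom hz]
  rw [← hj, ← hfix]

theorem mem_gvars_iff_isGround_rt : y ∈ σ.gvars ↔ (rt (.var y) σ).IsGround := by
  rw [Tree.IsGround, Set.eq_empty_iff_forall_notMem]
  simp only [← mem_occ_iff_mem_vars_rt]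
  refine ⟨And.right, fun h => ⟨?_, h⟩⟩
  -- Off the domain `y` is its own limit, which is not ground.
  by_contra hy
  refine h y (mem_occ_iff_mem_vars_rt.2 ?_)
  rw [rt_eq_of_iter_eq_var (i := 0) hy rfl]
  exact ⟨[], rfl⟩

theorem mem_fvars_iff_isFree_rt : y ∈ σ.fvars ↔ (rt (.var y) σ).IsFree := by
  constructor
  · rintro ⟨z, hz⟩
    have h : apply (.var y) (σ.1.pow σ.card) = .var z :=
      labelAt_nil_eq_var_iff.1 (congrArg (fun t => t.label []) hz)
    exact ⟨z, rt_eq_of_iter_eq_var (σ.2.notMem_dom_of_pow_card h) h⟩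
  · rintro ⟨z, hz⟩
    obtain ⟨i, hi, hle⟩ :=
      ((rt_spec (.var y) σ []).and (eventually_ge_atTop σ.card)).exists
    rw [hz] at hi
    have h : apply (.var y) (σ.1.pow i) = .var z := labelAt_nil_eq_var_iff.1 hi
    rw [← Nat.add_sub_cancel' hle, apply_pow_add] at h
    change ∃ x, toTree _ = _
    -- A compound iterate would stay compound and could not become `z` later.
    rcases hx : apply (L := L) (.var y) (σ.1.pow σ.card) with x | ⟨f, ts⟩
    · exact ⟨x, rfl⟩
    · rw [hx] at h
      cases h

theorem mem_lvars_iff_isLinear_rt : y ∈ σ.lvars ↔ (rt (.var y) σ).IsLinear := by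
  refine forall_congr' fun z => ?_
  refine imp_congr_ctx mem_occ_iff_mem_vars_rt fun hz => ?_
  have hz := notMem_dom_of_mem_vars_rt hz
  -- "Exactly one" is "at least one and not at least two"; the cap 2 is what requires `2 * σ.card`
  -- steps.
  rw [Tree.occLin_iff, Tree.occLin_iff, le_mvars_rt_iff hz 1 (by omega : _ ≤ 2 * σ.card),
    le_mvars_rt_iff hz 2 le_rfl]

end RationalTrees

theorem mainTheorem7 {L : FirstOrder.Language} {V : Type*} (σ : RationalTrees.RSubst L V)
    (y v : V) :
    (y ∈ σ.occ v ↔ v ∈ (RationalTrees.rt (FirstOrder.Language.Term.var y) σ).vars) ∧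
    (y ∈ σ.gvars ↔ (RationalTrees.rt (FirstOrder.Language.Term.var y) σ).IsGround) ∧
    (y ∈ σ.fvars ↔ (RationalTrees.rt (FirstOrder.Language.Term.var y) σ).IsFree) ∧
    (y ∈ σ.lvars ↔ (RationalTrees.rt (FirstOrder.Language.Term.var y) σ).IsLinear) := by
  exact ⟨RationalTrees.mem_occ_iff_mem_vars_rt, RationalTrees.mem_gvars_iff_isGround_rt,
    RationalTrees.mem_fvars_iff_isFree_rt, RationalTrees.mem_lvars_iff_isLinear_rt⟩
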